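/- Let $n\ge 0$ and let $M$ be a smooth manifold of dimension $2n+1$ (without boundary) with a smooth Riemannian metric $g$. Let $(\varphi,\xi,\eta,g)$ be a Sasakian structure on $M$. That is, $\varphi$ is a smooth $(1,1)$-tensor field, $\xi$ a smooth vector field and $\eta$ a smooth 1-form such that, for all vector fields $X,Y$, $$\varphi^2X=-X+\eta(X)\xi,\quad \eta(\xi)=1,\quad \varphi\xi=0,\quad \eta\circ\varphi=0,\quad g(\varphi X,\varphi Y)=g(X,Y)-\eta(X)\eta(Y)$$ (almost contact metric structure), $d\eta(X,Y)=g(X,\varphi Y)$ (contact metric structure), and $[\varphi,\varphi]+2\,d\eta\otimes\xi=0$ (normality), where $$d\eta(X,Y)=\tfrac12\big(X(\eta(Y))-Y(\eta(X))-\eta([X,Y])\big),\qquad [\varphi,\varphi](X,Y)=\varphi^2[X,Y]+[\varphi X,\varphi Y]-\varphi[\varphi X,Y]-\varphi[X,\varphi Y].$$ Let $\nabla$ be the Levi-Civita connection of $g$, $R(X,Y)Z=\nabla_X\nabla_YZ-\nabla_Y\nabla_XZ-\nabla_{[X,Y]}Z$ its curvature, and $R(X,Y,Z,W)=g(R(X,Y)Z,W)$.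 For an orthonormal basis $e_1,\dots,e_{2n+1}$ of a tangent space, let $Ric(X,Y)=\sum_{i}R(e_i,X,Y,e_i)$ be the Ricci tensor, and define the $*$-Ricci tensor by $$Ric^*(X,Y)=\sum_{i=1}^{2n+1}R(X,e_i,\varphi e_i,\varphi Y).$$ Then, for all tangent vectors $X,Y$ at any point of $M$, $$Ric^*(X,Y)=Ric(X,Y)-(2n-1)\,g(X,Y)-\eta(X)\eta(Y).$$ -/

import Mathlib

open Bundle VectorField FiberBundle
open scoped Manifold ContDiff

noncomputable section

namespace Riem

variable {E : Type*} [NormedAddCommGroup E] [NormedSpace ℝ E]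
  {H : Type*} [TopologicalSpace H] {I : ModelWithCorners ℝ E H}
  {M : Type*} [TopologicalSpace M] [ChartedSpace H M] [IsManifold I ∞ M]
  [RiemannianBundle (fun x : M ↦ TangentSpace I x)]

/-! ### The Levi-Civita connection -/

/-- The differential at `x` of the function `g(X, Y)`. -/
def dInner (X Y : Π x : M, TangentSpace I x) (x : M) : TangentSpace I x →L[ℝ] ℝ :=
  mvfderiv I (fun y ↦ (inner ℝ (X y) (Y y) : ℝ)) x

/-- The right-hand side of the Koszul formula for `g(∇_X Y, Z)`, at the point `x`. -/
def koszul (X Y Z : Π x : M, TangentSpace I x) (x : M) : ℝ :=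
  (dInner Y Z x (X x) + dInner X Z x (Y x) - dInner X Y x (Z x)
    + inner ℝ (mlieBracket I X Y x) (Z x)
    - inner ℝ (mlieBracket I X Z x) (Y x)
    - inner ℝ (mlieBracket I Y Z x) (X x)) / 2

lemma dInner_comm (X Y : Π x : M, TangentSpace I x) (x : M) : dInner X Y x = dInner Y X x := by
  simp only [dInner, real_inner_comm]

section

variable [IsContMDiffRiemannianBundle I ∞ E (fun x : M ↦ TangentSpace I x)]

lemma mdifferentiableAt_inner {X Y : Π x : M, TangentSpace I x} {x : M}
    (hX : MDiffAt (T% X) x) (hY : MDiffAt (T% Y) x) :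
    MDiffAt (fun y ↦ (inner ℝ (X y) (Y y) : ℝ)) x :=
  MDifferentiableAt.inner_bundle (IB := I) (F := E) (E := fun x : M ↦ TangentSpace I x)
    (b := fun y ↦ y) (v := X) (w := Y) hX hY

lemma dInner_add_left {X X' Y : Π x : M, TangentSpace I x} {x : M}
    (hX : MDiffAt (T% X) x) (hX' : MDiffAt (T% X') x) (hY : MDiffAt (T% Y) x) :
    dInner (X + X') Y x = dInner X Y x + dInner X' Y x := by
  simp only [dInner, Pi.add_apply, inner_add_left]
  exact mvfderiv_fun_add (mdifferentiableAt_inner hX hY) (mdifferentiableAt_inner hX' hY)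

lemma dInner_smul_left {f : M → ℝ} {X Y : Π x : M, TangentSpace I x} {x : M}
    (hf : MDiffAt f x) (hX : MDiffAt (T% X) x) (hY : MDiffAt (T% Y) x) :
    dInner (f • X) Y x = f x • dInner X Y x + (inner ℝ (X x) (Y x) : ℝ) • mvfderiv I f x := by
  simp only [dInner, Pi.smul_apply', real_inner_smul_left]
  exact mvfderiv_fun_mul hf (mdifferentiableAt_inner hX hY)

lemma dInner_add_right {X Y Y' : Π x : M, TangentSpace I x} {x : M}
    (hX : MDiffAt (T% X) x) (hY : MDiffAt (T% Y) x) (hY' : MDiffAt (T% Y') x) :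
    dInner X (Y + Y') x = dInner X Y x + dInner X Y' x := by
  rw [dInner_comm, dInner_add_left hY hY' hX, dInner_comm Y, dInner_comm Y']

lemma dInner_smul_right {f : M → ℝ} {X Y : Π x : M, TangentSpace I x} {x : M}
    (hf : MDiffAt f x) (hX : MDiffAt (T% X) x) (hY : MDiffAt (T% Y) x) :
    dInner X (f • Y) x = f x • dInner X Y x + (inner ℝ (X x) (Y x) : ℝ) • mvfderiv I f x := by
  rw [dInner_comm, dInner_smul_left hf hY hX, dInner_comm Y, real_inner_comm]

variable [FiniteDimensional ℝ E]

lemma koszul_tensorial_left {Y Z : Π x : M, TangentSpace I x} {x : M} (hY : MDiffAt (T% Y) x)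
    (hZ : MDiffAt (T% Z) x) : TensorialAt I E (fun X ↦ koszul X Y Z x) x where
  smul {f X} hf hX := by
    simp only [koszul, dInner_smul_left hf hX hZ, dInner_smul_left hf hX hY,
      mlieBracket_smul_left hf hX, Pi.smul_apply', inner_add_left, real_inner_smul_left,
      real_inner_smul_right, add_apply, smul_apply, map_smul, smul_eq_mul, inner_neg_left,
      neg_smul]
    ring
  add {X X'} hX hX' := by
    simp only [koszul, dInner_add_left hX hX' hZ, dInner_add_left hX hX' hY,
      mlieBracket_add_left hX hX', Pi.add_apply, inner_add_left, inner_add_right, map_add,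
      add_apply]
    ring

lemma koszul_tensorial_right {X Y : Π x : M, TangentSpace I x} {x : M} (hX : MDiffAt (T% X) x)
    (hY : MDiffAt (T% Y) x) : TensorialAt I E (fun Z ↦ koszul X Y Z x) x where
  smul {f Z} hf hZ := by
    simp only [koszul, dInner_smul_right hf hX hZ, dInner_smul_right hf hY hZ,
      mlieBracket_smul_right hf hZ, Pi.smul_apply', inner_add_left, real_inner_smul_left,
      real_inner_smul_right, add_apply, smul_apply, map_smul, smul_eq_mul, real_inner_comm]
    ring
  add {Z Z'} hZ hZ' := by
    simp only [koszul, dInner_add_right hX hZ hZ', dInner_add_right hY hZ hZ',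
      mlieBracket_add_right hZ hZ', Pi.add_apply, inner_add_left, inner_add_right, map_add,
      add_apply]
    ring

lemma koszul_add_middle {X Y Y' Z : Π x : M, TangentSpace I x} {x : M} (hX : MDiffAt (T% X) x)
    (hY : MDiffAt (T% Y) x) (hY' : MDiffAt (T% Y') x) (hZ : MDiffAt (T% Z) x) :
    koszul X (Y + Y') Z x = koszul X Y Z x + koszul X Y' Z x := by
  simp only [koszul, dInner_add_left hY hY' hZ, dInner_add_right hX hY hY',
    mlieBracket_add_left hY hY', mlieBracket_add_right hY hY', Pi.add_apply, inner_add_left,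
    inner_add_right, map_add, add_apply]
  ring

lemma koszul_smul_middle {f : M → ℝ} {X Y Z : Π x : M, TangentSpace I x} {x : M}
    (hf : MDiffAt f x) (hX : MDiffAt (T% X) x) (hY : MDiffAt (T% Y) x) (hZ : MDiffAt (T% Z) x) :
    koszul X (f • Y) Z x
      = f x * koszul X Y Z x + mvfderiv I f x (X x) * inner ℝ (Y x) (Z x) := by
  simp only [koszul, dInner_smul_left hf hY hZ, dInner_smul_right hf hX hY,
    mlieBracket_smul_left hf hY, mlieBracket_smul_right hf hY, Pi.smul_apply', inner_add_left,
    real_inner_smul_left, real_inner_smul_right, add_apply, smul_apply, map_smul, smul_eq_mul,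
    inner_neg_left, neg_smul, real_inner_comm]
  ring

instance (x : M) : FiniteDimensional ℝ (TangentSpace I x) :=
  inferInstanceAs (FiniteDimensional ℝ E)

instance (x : M) : CompleteSpace (TangentSpace I x) :=
  FiniteDimensional.complete ℝ (TangentSpace I x)

open Classical in
/-- The map `v ↦ ∇_v Y` at the point `x`: the vector `∇_v Y` represents, with respect to the metric,
the linear form given by the Koszul formula. It is set to zero where `Y` is not differentiable. -/
def leviCivitaAux (Y : Π x : M, TangentSpace I x) (x : M) :
    TangentSpace I x →L[ℝ] TangentSpace I x :=
  if hY : MDiffAt (T% Y) x then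
    let B : TangentSpace I x →L[ℝ] TangentSpace I x →L[ℝ] ℝ :=
      TensorialAt.mkHom₂ (I := I) (F := E) (F' := E) (fun X Z ↦ koszul X Y Z x) x
        (fun _ hZ ↦ koszul_tensorial_left hY hZ) (fun _ hX ↦ koszul_tensorial_right hX hY)
    LinearMap.toContinuousLinearMap
      { toFun := fun v ↦ (InnerProductSpace.toDual ℝ (TangentSpace I x)).symm (B v)
        map_add' := fun v w ↦ by simp
        map_smul' := fun c v ↦ by simp }
  else 0

/-- The Koszul formula. -/
lemma inner_leviCivitaAux {X Y Z : Π x : M, TangentSpace I x} {x : M}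
    (hX : MDiffAt (T% X) x) (hY : MDiffAt (T% Y) x) (hZ : MDiffAt (T% Z) x) :
    inner ℝ (leviCivitaAux Y x (X x)) (Z x) = koszul X Y Z x := by
  rw [leviCivitaAux, dif_pos hY, LinearMap.coe_toContinuousLinearMap', LinearMap.coe_mk,
    AddHom.coe_mk, InnerProductSpace.toDual_symm_apply]
  exact TensorialAt.mkHom₂_apply _ _ hX hZ

lemma leviCivitaAux_ext {x : M} {A B : TangentSpace I x →L[ℝ] TangentSpace I x}
    (h : ∀ X Z : Π x : M, TangentSpace I x, MDiffAt (T% X) x → MDiffAt (T% Z) x →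
      (inner ℝ (A (X x)) (Z x) : ℝ) = inner ℝ (B (X x)) (Z x)) : A = B := by
  refine ContinuousLinearMap.ext fun v ↦ ext_inner_right ℝ fun w ↦ ?_
  have := h (extend E v) (extend E w) (mdifferentiableAt_extend I E v)
    (mdifferentiableAt_extend I E w)
  rwa [extend_apply_self, extend_apply_self] at this

lemma isCovariantDerivativeOn_leviCivitaAux :
    IsCovariantDerivativeOn E (leviCivitaAux (I := I) (M := M)) where
  add {Y Y' x} hY hY' _ := leviCivitaAux_ext fun X Z hX hZ ↦ by
    rw [inner_leviCivitaAux hX (mdifferentiableAt_add_section hY hY') hZ, add_apply,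
      inner_add_left, inner_leviCivitaAux hX hY hZ, inner_leviCivitaAux hX hY' hZ,
      koszul_add_middle hX hY hY' hZ]
  leibniz {Y f x} hY hf _ := leviCivitaAux_ext fun X Z hX hZ ↦ by
    rw [inner_leviCivitaAux hX (hf.smul_section hY) hZ, add_apply, smul_apply,
      ContinuousLinearMap.smulRight_apply, inner_add_left, real_inner_smul_left,
      real_inner_smul_left, inner_leviCivitaAux hX hY hZ, koszul_smul_middle hf hX hY hZ]

variable (I M) in
/-- The Levi-Civita connection of the metric. -/
def leviCivita : CovariantDerivative I E (fun x : M ↦ TangentSpace I x) :=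
  ⟨leviCivitaAux, isCovariantDerivativeOn_leviCivitaAux⟩

/-- The Levi-Civita connection is torsion-free. -/
lemma leviCivita_torsion : (leviCivita I M).torsion = 0 := by
  rw [CovariantDerivative.torsion_eq_zero_iff]
  intro X Y x hX hY
  refine ext_inner_right ℝ fun w ↦ ?_
  have h1 := inner_leviCivitaAux hX hY (mdifferentiableAt_extend I E w)
  have h2 := inner_leviCivitaAux hY hX (mdifferentiableAt_extend I E w)
  rw [extend_apply_self] at h1 h2
  rw [inner_sub_left]
  refine (congrArg₂ (· - ·) h1 h2).trans ?_
  simp only [koszul, dInner_comm Y X, mlieBracket_swap_apply (V := Y) (W := X), inner_neg_left,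
    extend_apply_self]
  ring

/-- The Levi-Civita connection is compatible with the metric. -/
lemma leviCivita_metric {X Y Z : Π x : M, TangentSpace I x} {x : M}
    (hX : MDiffAt (T% X) x) (hY : MDiffAt (T% Y) x) (hZ : MDiffAt (T% Z) x) :
    mvfderiv I (fun y ↦ (inner ℝ (Y y) (Z y) : ℝ)) x (X x)
      = inner ℝ (leviCivita I M Y x (X x)) (Z x) + inner ℝ (Y x) (leviCivita I M Z x (X x)) := by
  have h1 := inner_leviCivitaAux hX hY hZ
  have h2 := inner_leviCivitaAux hX hZ hY
  rw [real_inner_comm] at h2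
  refine Eq.trans ?_ (congrArg₂ (· + ·) h1 h2).symm
  simp only [koszul, dInner_comm Z Y, mlieBracket_swap_apply (V := Z) (W := Y), inner_neg_left]
  simp only [dInner]
  ring

/-! ### Curvature -/

/-- The curvature operator `R(u, v) w = ∇_u ∇_v w - ∇_v ∇_u w - ∇_[u, v] w` at the point `x`; the
tangent vectors `u`, `v`, `w` are extended to vector fields that are smooth near `x`. -/
def curvature (x : M) (u v w : TangentSpace I x) : TangentSpace I x :=
  let U : Π y : M, TangentSpace I y := extend E u
  let V : Π y : M, TangentSpace I y := extend E v
  let W : Π y : M, TangentSpace I y := extend E w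
  leviCivita I M (fun y ↦ leviCivita I M W y (V y)) x u
    - leviCivita I M (fun y ↦ leviCivita I M W y (U y)) x v
    - leviCivita I M W x (mlieBracket I U V x)

/-- The curvature tensor `R(u, v, w, z) = g(R(u, v) w, z)`. -/
def curvatureForm (x : M) (u v w z : TangentSpace I x) : ℝ :=
  inner ℝ (curvature x u v w) z

/-- The Ricci tensor, with the sign that makes it positive on round spheres; the sum is over
an orthonormal basis of the tangent space. -/
def ricci (x : M) (u v : TangentSpace I x) : ℝ :=
  let e := stdOrthonormalBasis ℝ (TangentSpace I x)
  ∑ i, curvatureForm x (e i) u v (e i)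

end

/-! ### Sasakian structures -/

section

/-- `(dα)(X, Y) = (X(α(Y)) - Y(α(X)) - α([X, Y])) / 2` at the point `x`. -/
def extDeriv (α : Π x : M, TangentSpace I x →L[ℝ] ℝ) (X Y : Π x : M, TangentSpace I x) (x : M) :
    ℝ :=
  (mvfderiv I (fun y ↦ α y (Y y)) x (X x) - mvfderiv I (fun y ↦ α y (X y)) x (Y x)
    - α x (mlieBracket I X Y x)) / 2

/-- `[φ, φ](X, Y) = φ²[X, Y] + [φX, φY] - φ[φX, Y] - φ[X, φY]` at the point `x`. -/
def nijenhuis (φ : Π x : M, TangentSpace I x →L[ℝ] TangentSpace I x)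
    (X Y : Π x : M, TangentSpace I x) (x : M) : TangentSpace I x :=
  φ x (φ x (mlieBracket I X Y x))
    + mlieBracket I (fun y ↦ φ y (X y)) (fun y ↦ φ y (Y y)) x
    - φ x (mlieBracket I (fun y ↦ φ y (X y)) Y x)
    - φ x (mlieBracket I X (fun y ↦ φ y (Y y)) x)

end

variable (I M) in
/-- An almost contact metric structure `(φ, ξ, η)` on a manifold with Riemannian metric. -/
structure AlmostContactMetric where
  /-- the `(1,1)`-tensor field -/
  φ : Π x : M, TangentSpace I x →L[ℝ] TangentSpace I x
  /-- the Reeb vector field -/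
  ξ : Π x : M, TangentSpace I x
  /-- the contact form -/
  η : Π x : M, TangentSpace I x →L[ℝ] ℝ
  φ_smooth : ContMDiff I (I.prod 𝓘(ℝ, E →L[ℝ] E)) ∞
    (fun x ↦ TotalSpace.mk' (E →L[ℝ] E)
      (E := fun x : M ↦ TangentSpace I x →L[ℝ] TangentSpace I x) x (φ x))
  ξ_smooth : ContMDiff I (I.prod 𝓘(ℝ, E)) ∞
    (fun x ↦ TotalSpace.mk' E (E := fun x : M ↦ TangentSpace I x) x (ξ x))
  η_smooth : ContMDiff I (I.prod 𝓘(ℝ, E →L[ℝ] ℝ)) ∞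
    (fun x ↦ TotalSpace.mk' (E →L[ℝ] ℝ)
      (E := fun x : M ↦ TangentSpace I x →L[ℝ] Bundle.Trivial M ℝ x) x (η x))
  φ_φ : ∀ x u, φ x (φ x u) = -u + η x u • ξ x
  η_ξ : ∀ x, η x (ξ x) = 1
  φ_ξ : ∀ x, φ x (ξ x) = 0
  η_φ : ∀ x u, η x (φ x u) = 0
  inner_φ_φ : ∀ x (u v : TangentSpace I x),
    (inner ℝ (φ x u) (φ x v) : ℝ) = inner ℝ u v - η x u * η x v

variable (I M) in
/-- A Sasakian structure: an almost contact metric structure that is contact metric,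
`dη(X, Y) = g(X, φY)`, and normal, `[φ, φ] + 2 dη ⊗ ξ = 0`. -/
structure Sasakian extends AlmostContactMetric I M where
  contact : ∀ (x : M) (X Y : Π y : M, TangentSpace I y),
    ContMDiffAt I (I.prod 𝓘(ℝ, E)) ∞ (T% X) x → ContMDiffAt I (I.prod 𝓘(ℝ, E)) ∞ (T% Y) x →
    extDeriv η X Y x = inner ℝ (X x) (φ x (Y x))
  normal : ∀ (x : M) (X Y : Π y : M, TangentSpace I y),
    ContMDiffAt I (I.prod 𝓘(ℝ, E)) ∞ (T% X) x → ContMDiffAt I (I.prod 𝓘(ℝ, E)) ∞ (T% Y) x →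
    nijenhuis φ X Y x + (2 * extDeriv η X Y x) • ξ x = 0

/-- The `*`-Ricci tensor `Ric*(u, v) = ∑ R(u, e_i, φ e_i, φ v)` of an almost contact metric
structure; the sum is over an orthonormal basis of the tangent space. -/
def AlmostContactMetric.starRicci [FiniteDimensional ℝ E]
    [IsContMDiffRiemannianBundle I ∞ E (fun x : M ↦ TangentSpace I x)]
    (S : AlmostContactMetric I M) (x : M) (u v : TangentSpace I x) : ℝ :=
  let e := stdOrthonormalBasis ℝ (TangentSpace I x)
  ∑ i, curvatureForm x u (e i) (S.φ x (e i)) (S.φ x v)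

end Riem

end

/-! The identity is a trace of a commutator formula for the curvature. On a Sasakian manifold ∇_X ξ
= -φX and (∇_X φ)Y = g(X,Y)ξ - η(Y)X (`cov_ξ_and_covφ`). Differentiating once more gives R(X,Y)ξ =
η(Y)X - η(X)Y and expresses R(X,Y)φZ - φR(X,Y)Z through g and φ alone (`curvature_ξ`,
`curvature_φ`). For a unit vector e this turns R(u,e,φe,φv) into R(e,u,v,e) - g(u,v) +
g(φu,e)g(e,φv) + g(u,e)g(e,v), and summing over an orthonormal basis finishes the proof. Of the
symmetries of R only skewness in each pair is used.

The formulas for ∇ξ and ∇φ are linear algebra at a point. Metric compatibility makes ∇φ skew, dη =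
g(·,φ·) is closed and so gives a cyclic identity, and normality becomes a relation between values of
∇φ. These determine ∇ξ (`nabla_reeb_of_normal`) and then ∇φ (`nabla_φ_of_normal`).

The groundwork lets all this be computed with globally smooth fields: ∇_X Y is smooth, [X,Y] acts as
a commutator of derivations, and pointwise curvature agrees with curvature of fields. -/

noncomputable section

namespace Riem

open scoped Topology

variable {E : Type*} [NormedAddCommGroup E] [NormedSpace ℝ E]
  {H : Type*} [TopologicalSpace H] {I : ModelWithCorners ℝ E H}
  {M : Type*} [TopologicalSpace M] [ChartedSpace H M] [IsManifold I ∞ M]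

/-! ### Global smooth vector fields -/

section Fields

variable [FiniteDimensional ℝ E]

/-- A local section that is smooth near a point agrees near that point with a globally smooth
vector field. -/
lemma exists_contMDiff_eventuallyEq [T2Space M] {x : M} {σ : Π y : M, TangentSpace I y}
    {s : Set M} (hs : s ∈ 𝓝 x) (hσ : CMDiff[s] ∞ (T% σ)) :
    ∃ X : Π y : M, TangentSpace I y, CMDiff ∞ (T% X) ∧ ∀ᶠ y in 𝓝 x, σ y = X y := by
  obtain ⟨t, hts, ht, hxt⟩ := mem_nhds_iff.1 hs
  obtain ⟨ψ, -, hψ⟩ := (SmoothBumpFunction.nhds_basis_tsupport (I := I) x).mem_iff.1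
    (ht.mem_nhds hxt)
  refine ⟨(ψ : M → ℝ) • σ,
    ContMDiffOn.smul_section_of_tsupport ψ.contMDiff.contMDiffOn ht hψ (hσ.mono hts), ?_⟩
  filter_upwards [ψ.eventuallyEq_one] with y hy
  simp [hy]

lemma exists_contMDiff_eventuallyEq_extend [T2Space M] {x : M} (u : TangentSpace I x) :
    ∃ X : Π y : M, TangentSpace I y, CMDiff ∞ (T% X) ∧
      ∀ᶠ y in 𝓝 x, (extend E u : Π y : M, TangentSpace I y) y = X y := by
  obtain ⟨s, hs, hsu⟩ := exists_contMDiffOn_extend (k := ∞) I E u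
  exact exists_contMDiff_eventuallyEq hs hsu

lemma exists_contMDiff_apply_eq [T2Space M] {x : M} (u : TangentSpace I x) :
    ∃ X : Π y : M, TangentSpace I y, CMDiff ∞ (T% X) ∧ X x = u := by
  obtain ⟨X, hX, h⟩ := exists_contMDiff_eventuallyEq_extend u
  exact ⟨X, hX, by rw [← h.self_of_nhds, extend_apply_self]⟩

lemma contMDiff_mlieBracket {X Y : Π y : M, TangentSpace I y} (hX : CMDiff ∞ (T% X))
    (hY : CMDiff ∞ (T% Y)) : CMDiff ∞ (T% (mlieBracket I X Y)) := by
  have : IsManifold I (((⊤ : ℕ∞) : WithTop ℕ∞) + 1) M := inferInstanceAs (IsManifold I ∞ M)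
  have : IsManifold I (minSmoothness ℝ 2) M :=
    IsManifold.of_le (n := ∞) (by simpa using ENat.LEInfty.out)
  have : CompleteSpace E := FiniteDimensional.complete ℝ E
  exact ContDiff.mlieBracket_vectorField (m := ⊤) (n := ⊤) hX hY (by simp)

lemma mlieBracket_jacobi {X Y Z : Π y : M, TangentSpace I y} (hX : CMDiff ∞ (T% X))
    (hY : CMDiff ∞ (T% Y)) (hZ : CMDiff ∞ (T% Z)) (x : M) :
    mlieBracket I X (mlieBracket I Y Z) x =
      mlieBracket I (mlieBracket I X Y) Z x + mlieBracket I Y (mlieBracket I X Z) x := by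
  have : IsManifold I (minSmoothness ℝ 3) M := 
    IsManifold.of_le (n := ∞) (by simpa using ENat.LEInfty.out)
  have : CompleteSpace E := FiniteDimensional.complete ℝ E
  have h2 : minSmoothness ℝ 2 ≤ ∞ := by simpa using ENat.LEInfty.out
  exact leibniz_identity_mlieBracket_apply ((hX x).of_le h2) ((hY x).of_le h2) ((hZ x).of_le h2)

end Fields

/-- The derivative of a function along a vector field. -/
def lieDeriv (X : Π y : M, TangentSpace I y) (f : M → ℝ) (x : M) : ℝ := mvfderiv I f x (X x)

lemma mdiffAt_of_contMDiff {X : Π y : M, TangentSpace I y} (hX : CMDiff ∞ (T% X)) (x : M) :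
    MDiffAt (T% X) x := (hX x).mdifferentiableAt (by simp)

omit [IsManifold I ∞ M] in
lemma mdiffAt_fun_of_contMDiff {f : M → ℝ} (hf : CMDiff ∞ f) (x : M) : MDiffAt f x :=
  (hf x).mdifferentiableAt (by simp)

omit [IsManifold I ∞ M] in
lemma lieDeriv_add (X : Π y : M, TangentSpace I y) {f g : M → ℝ} (hf : CMDiff ∞ f)
    (hg : CMDiff ∞ g) (x : M) :
    lieDeriv X (fun y ↦ f y + g y) x = lieDeriv X f x + lieDeriv X g x := by
  simp only [lieDeriv,
    mvfderiv_fun_add (mdiffAt_fun_of_contMDiff hf x) (mdiffAt_fun_of_contMDiff hg x), add_apply]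

omit [IsManifold I ∞ M] in
lemma lieDeriv_sub (X : Π y : M, TangentSpace I y) {f g : M → ℝ} (hf : CMDiff ∞ f)
    (hg : CMDiff ∞ g) (x : M) :
    lieDeriv X (fun y ↦ f y - g y) x = lieDeriv X f x - lieDeriv X g x := by
  simp only [lieDeriv,
    mvfderiv_fun_sub (mdiffAt_fun_of_contMDiff hf x) (mdiffAt_fun_of_contMDiff hg x), sub_apply]

/-! ### Vector fields as derivations of smooth functions -/

section Derivations

variable [RiemannianBundle (fun x : M ↦ TangentSpace I x)]
  [IsContMDiffRiemannianBundle I ∞ E (fun x : M ↦ TangentSpace I x)]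

lemma contMDiff_inner {X Y : Π y : M, TangentSpace I y} (hX : CMDiff ∞ (T% X))
    (hY : CMDiff ∞ (T% Y)) : CMDiff ∞ (fun y ↦ (inner ℝ (X y) (Y y) : ℝ)) :=
  ContMDiff.inner_bundle (IB := I) (F := E) (E := fun x : M ↦ TangentSpace I x)
    (b := fun y ↦ y) (v := X) (w := Y) hX hY

variable [FiniteDimensional ℝ E] [T2Space M] [Nontrivial E]

/-- The smooth field [X, fZ] - f[X, Z] equals (Xf)Z. With Z nonzero at `x`, pairing with Z and
dividing by g(Z,Z) recovers Xf near `x`. -/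
lemma contMDiff_lieDeriv {X : Π y : M, TangentSpace I y} {f : M → ℝ} (hX : CMDiff ∞ (T% X))
    (hf : CMDiff ∞ f) : CMDiff ∞ (lieDeriv X f) := by
  intro x
  obtain ⟨v, hv⟩ := exists_ne (0 : E)
  obtain ⟨Z, hZ, hZx⟩ := exists_contMDiff_apply_eq (x := x) (I := I) v
  have h : CMDiff ∞ (T% (mlieBracket I X (f • Z) - f • mlieBracket I X Z)) :=
    (contMDiff_mlieBracket hX (hf.smul_section hZ)).sub_section
      (hf.smul_section (contMDiff_mlieBracket hX hZ))
  have h1 := (contMDiff_inner h hZ) x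
  have h2 := (contMDiff_inner hZ hZ) x
  have hne : (inner ℝ (Z x) (Z x) : ℝ) ≠ 0 := by
    rw [hZx]; exact inner_self_ne_zero.2 hv
  refine (h1.div₀ h2 hne).congr_of_eventuallyEq ?_
  filter_upwards [h2.continuousAt.eventually_ne hne] with y hy
  rw [Pi.div_apply, Pi.sub_apply, mlieBracket_smul_right (mdiffAt_fun_of_contMDiff hf y)
    (mdiffAt_of_contMDiff hZ y), Pi.smul_apply', add_sub_cancel_right, real_inner_smul_left,
    mul_div_cancel_right₀ _ hy, lieDeriv]

/-- The Lie bracket acts on functions as the commutator of derivations. -/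
lemma lieDeriv_mlieBracket {X Y : Π y : M, TangentSpace I y} {f : M → ℝ} (hX : CMDiff ∞ (T% X))
    (hY : CMDiff ∞ (T% Y)) (hf : CMDiff ∞ f) (x : M) :
    lieDeriv (mlieBracket I X Y) f x
      = lieDeriv X (lieDeriv Y f) x - lieDeriv Y (lieDeriv X f) x := by
  obtain ⟨v, hv⟩ := exists_ne (0 : E)
  obtain ⟨Z, hZ, hZx⟩ := exists_contMDiff_apply_eq (x := x) (I := I) v
  have key : ∀ {W : Π y : M, TangentSpace I y} {h : M → ℝ} {V : Π y : M, TangentSpace I y},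
      CMDiff ∞ h → CMDiff ∞ (T% V) →
      mlieBracket I W (h • V) = lieDeriv W h • V + h • mlieBracket I W V := fun hh hV ↦
    funext fun y ↦ mlieBracket_smul_right (mdiffAt_fun_of_contMDiff hh y)
      (mdiffAt_of_contMDiff hV y)
  have key2 : ∀ {V W : Π y : M, TangentSpace I y}, CMDiff ∞ (T% V) → CMDiff ∞ (T% W) →
      mlieBracket I V (mlieBracket I W (f • Z)) x
        = lieDeriv V (lieDeriv W f) x • Z x + lieDeriv W f x • mlieBracket I V Z x
          + (lieDeriv V f x • mlieBracket I W Z x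
            + f x • mlieBracket I V (mlieBracket I W Z) x) := by
    intro V W hV hW
    have hWf := contMDiff_lieDeriv hW hf
    have hWZ := contMDiff_mlieBracket hW hZ
    rw [key hf hZ, mlieBracket_add_right (mdiffAt_of_contMDiff (hWf.smul_section hZ) x)
      (mdiffAt_of_contMDiff (hf.smul_section hWZ) x), key hWf hZ, key hf hWZ]
    rfl
  -- Subtracting f times the Jacobi identity for X, Y, Z from the one for X, Y, fZ leaves the
  -- desired scalar identity times Z, and Z does not vanish at `x`.
  have hj := mlieBracket_jacobi hX hY (hf.smul_section hZ) x
  have hj' := mlieBracket_jacobi hX hY hZ x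
  rw [key2 hX hY, key2 hY hX, key hf hZ] at hj
  simp only [Pi.add_apply, Pi.smul_apply', hj', smul_add] at hj
  have h0 : (lieDeriv (mlieBracket I X Y) f x
      - (lieDeriv X (lieDeriv Y f) x - lieDeriv Y (lieDeriv X f) x)) • Z x = 0 := by
    rw [sub_smul, sub_smul, sub_sub_eq_add_sub, sub_eq_zero, ← sub_eq_zero]
    rw [← sub_eq_zero] at hj
    rw [← neg_eq_zero, ← hj]
    abel
  rw [smul_eq_zero, sub_eq_zero] at h0
  exact h0.resolve_right (by rw [hZx]; exact hv)

end Derivations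

end Riem

/-! ### Smoothness tested by inner products -/

namespace Riem

open scoped Topology

variable {E : Type*} [NormedAddCommGroup E] [NormedSpace ℝ E] [FiniteDimensional ℝ E]
  {H : Type*} [TopologicalSpace H] {I : ModelWithCorners ℝ E H}
  {M : Type*} [TopologicalSpace M] [T2Space M] [ChartedSpace H M] [IsManifold I ∞ M]
  [RiemannianBundle (fun x : M ↦ TangentSpace I x)]
  [IsContMDiffRiemannianBundle I ∞ E (fun x : M ↦ TangentSpace I x)]

omit [FiniteDimensional ℝ E] [T2Space M] [IsManifold I ∞ M]
  [RiemannianBundle (fun x : M ↦ TangentSpace I x)]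
  [IsContMDiffRiemannianBundle I ∞ E (fun x : M ↦ TangentSpace I x)] in
lemma contMDiffAt_det {ι : Type*} [Fintype ι] [DecidableEq ι] {G : M → Matrix ι ι ℝ} {x : M}
    (hG : ∀ i j, CMDiffAt ∞ (fun y ↦ G y i j) x) : CMDiffAt ∞ (fun y ↦ (G y).det) x := by
  simp only [Matrix.det_apply']
  exact contMDiffAt_finsetSum fun σ _ ↦ contMDiffAt_const.mul
    (contMDiffAt_finsetProd fun i _ ↦ hG _ _)

omit [FiniteDimensional ℝ E] [T2Space M] [IsManifold I ∞ M]
  [RiemannianBundle (fun x : M ↦ TangentSpace I x)]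
  [IsContMDiffRiemannianBundle I ∞ E (fun x : M ↦ TangentSpace I x)] in
lemma contMDiffAt_adjugate {ι : Type*} [Fintype ι] [DecidableEq ι] {G : M → Matrix ι ι ℝ} {x : M}
    (hG : ∀ i j, CMDiffAt ∞ (fun y ↦ G y i j) x) (i j : ι) :
    CMDiffAt ∞ (fun y ↦ (G y).adjugate i j) x := by
  simp only [Matrix.adjugate_apply]
  refine contMDiffAt_det fun k l ↦ ?_
  by_cases hk : k = j
  · subst hk
    simpa only [Matrix.updateRow_self] using contMDiffAt_const
  · simpa only [Matrix.updateRow_ne hk] using hG k l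

/-- A vector field is smooth if its inner products with all smooth vector fields are. -/
lemma contMDiff_of_inner {σ : Π y : M, TangentSpace I y}
    (h : ∀ Z : Π y : M, TangentSpace I y, CMDiff ∞ (T% Z) →
      CMDiff ∞ (fun y ↦ (inner ℝ (σ y) (Z y) : ℝ))) : CMDiff ∞ (T% σ) := by
  classical
  intro x
  let t := trivializationAt E (fun y : M ↦ TangentSpace I y) x
  have hx : x ∈ t.baseSet := FiberBundle.mem_baseSet_trivializationAt' x
  let b := Module.finBasis ℝ E
  rw [contMDiffAt_iff_localFrameCoeff (e := t) b hx]
  -- The hypothesis only tests against global fields, so the local frame is replaced by global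
  -- fields with the same germs at `x`. Cramer's rule for their Gram matrix then expresses the
  -- coefficients of σ through its inner products with them.
  have hfr : ∀ i, ∃ X : Π y : M, TangentSpace I y, CMDiff ∞ (T% X) ∧
      ∀ᶠ y in 𝓝 x, t.localFrame b i y = X y := fun i ↦
    exists_contMDiff_eventuallyEq (t.open_baseSet.mem_nhds hx)
      (t.contMDiffOn_localFrame_baseSet ∞ b i)
  choose X hX hXe using hfr
  let G : M → Matrix _ _ ℝ := fun y ↦ Matrix.gram ℝ (fun i ↦ X i y)
  have hG : ∀ i j, CMDiffAt ∞ (fun y ↦ G y i j) x := fun i j ↦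
    contMDiff_inner (hX i) (hX j) x
  have hli : ∀ᶠ y in 𝓝 x, y ∈ t.baseSet ∧ ∀ i, t.localFrame b i y = X i y :=
    (t.open_baseSet.eventually_mem hx).and (Filter.eventually_all.2 hXe)
  have hdet : ∀ᶠ y in 𝓝 x, (G y).det ≠ 0 := by
    filter_upwards [hli] with y ⟨hy, hXy⟩
    refine (Matrix.posDef_gram_of_linearIndependent (𝕜 := ℝ) ?_).det_pos.ne'
    have := (t.isLocalFrameOn_localFrame_baseSet I ∞ b).linearIndependent hy
    simpa only [hXy] using this
  intro j
  have hb : CMDiffAt ∞ (fun y ↦ (∑ i, inner ℝ (σ y) (X i y) * (G y).adjugate i j)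
      / (G y).det) x :=
    (contMDiffAt_finsetSum fun i _ ↦ (h _ (hX i) x).mul (contMDiffAt_adjugate hG i j)).div₀
      (contMDiffAt_det hG) hdet.self_of_nhds
  refine hb.congr_of_eventuallyEq ?_
  filter_upwards [hli, hdet] with y ⟨hy, hXy⟩ hd
  have hs : σ y = ∑ i, t.localFrameCoeff I b i y (σ y) • X i y := by
    simpa only [hXy] using t.eq_sum_localFrameCoeff_smul (I := I) (b := b) (s := σ) hy
  let c := fun i ↦ t.localFrameCoeff I b i y (σ y)
  have hvec : (fun i ↦ (inner ℝ (σ y) (X i y) : ℝ)) = Matrix.vecMul c (G y) := by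
    funext i
    rw [hs, sum_inner]
    simp only [real_inner_smul_left, Matrix.vecMul, dotProduct, G, Matrix.gram_apply, c]
  have h2 : Matrix.vecMul (fun i ↦ (inner ℝ (σ y) (X i y) : ℝ)) (G y).adjugate
      = (G y).det • c := by
    rw [hvec, Matrix.vecMul_vecMul, Matrix.mul_adjugate, Matrix.vecMul_smul, Matrix.vecMul_one]
  rw [eq_div_iff hd, mul_comm]
  exact (congrFun h2 j).symm

/-! ### The Levi-Civita connection on smooth vector fields -/

/-- The covariant derivative `∇_X Y` of vector fields. -/
def cov (X Y : Π y : M, TangentSpace I y) (x : M) : TangentSpace I x := leviCivita I M Y x (X x)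

section

variable {X Y Z W : Π y : M, TangentSpace I y}

omit [T2Space M] in
lemma inner_cov (hX : CMDiff ∞ (T% X)) (hY : CMDiff ∞ (T% Y)) (hZ : CMDiff ∞ (T% Z)) (x : M) :
    (inner ℝ (cov X Y x) (Z x) : ℝ) = koszul X Y Z x :=
  inner_leviCivitaAux (mdiffAt_of_contMDiff hX x) (mdiffAt_of_contMDiff hY x)
    (mdiffAt_of_contMDiff hZ x)

omit [T2Space M] in
lemma cov_add (hY : CMDiff ∞ (T% Y)) (hZ : CMDiff ∞ (T% Z)) (x : M) :
    cov X (Y + Z) x = cov X Y x + cov X Z x := by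
  rw [cov, (leviCivita I M).isCovariantDerivativeOnUniv.add (mdiffAt_of_contMDiff hY x)
    (mdiffAt_of_contMDiff hZ x)]
  rfl

omit [T2Space M] in
lemma cov_smul {f : M → ℝ} (hf : CMDiff ∞ f) (hY : CMDiff ∞ (T% Y)) (x : M) :
    cov X (f • Y) x = f x • cov X Y x + lieDeriv X f x • Y x := by
  rw [cov, (leviCivita I M).isCovariantDerivativeOnUniv.leibniz (mdiffAt_of_contMDiff hY x)
    (mdiffAt_fun_of_contMDiff hf x)]
  rfl

omit [T2Space M] in
lemma cov_neg (hY : CMDiff ∞ (T% Y)) (x : M) : cov X (-Y) x = -cov X Y x := by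
  have h := cov_smul (X := X) (f := fun _ ↦ (-1 : ℝ)) contMDiff_const hY x
  have h1 : (fun _ : M ↦ (-1 : ℝ)) • Y = -Y := by funext y; simp
  rw [h1] at h
  rw [h, lieDeriv, mvfderiv_const]
  simp

omit [T2Space M] in
lemma cov_sub (hY : CMDiff ∞ (T% Y)) (hZ : CMDiff ∞ (T% Z)) (x : M) :
    cov X (Y - Z) x = cov X Y x - cov X Z x := by
  rw [sub_eq_add_neg, cov_add hY hZ.neg_section, cov_neg hZ, sub_eq_add_neg]

omit [T2Space M] in
lemma cov_sub_cov (hX : CMDiff ∞ (T% X)) (hY : CMDiff ∞ (T% Y)) (x : M) :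
    cov X Y x - cov Y X x = mlieBracket I X Y x :=
  ((leviCivita I M).torsion_eq_zero_iff.1 leviCivita_torsion)
    (mdiffAt_of_contMDiff hX x) (mdiffAt_of_contMDiff hY x)

omit [T2Space M] in
lemma lieDeriv_inner (hX : CMDiff ∞ (T% X)) (hY : CMDiff ∞ (T% Y)) (hZ : CMDiff ∞ (T% Z))
    (x : M) : lieDeriv X (fun y ↦ (inner ℝ (Y y) (Z y) : ℝ)) x
      = inner ℝ (cov X Y x) (Z x) + inner ℝ (Y x) (cov X Z x) :=
  leviCivita_metric (mdiffAt_of_contMDiff hX x) (mdiffAt_of_contMDiff hY x)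
    (mdiffAt_of_contMDiff hZ x)

variable [Nontrivial E]

/-- By the Koszul formula, g(∇_X Y, Z) is built from derivatives of inner products and from
brackets, hence smooth for every smooth Z. -/
lemma contMDiff_cov (hX : CMDiff ∞ (T% X)) (hY : CMDiff ∞ (T% Y)) :
    CMDiff ∞ (T% (cov X Y)) := by
  refine contMDiff_of_inner fun Z hZ ↦ ?_
  simp only [inner_cov hX hY hZ]
  exact ((((((contMDiff_lieDeriv hX (contMDiff_inner hY hZ)).add
    (contMDiff_lieDeriv hY (contMDiff_inner hX hZ))).sub
    (contMDiff_lieDeriv hZ (contMDiff_inner hX hY))).add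
    (contMDiff_inner (contMDiff_mlieBracket hX hY) hZ)).sub
    (contMDiff_inner (contMDiff_mlieBracket hX hZ) hY)).sub
    (contMDiff_inner (contMDiff_mlieBracket hY hZ) hX)).div_const 2

/-- The curvature `R(X, Y) Z` of vector fields. -/
def curv (X Y Z : Π y : M, TangentSpace I y) (x : M) : TangentSpace I x :=
  cov X (cov Y Z) x - cov Y (cov X Z) x - cov (mlieBracket I X Y) Z x

/-! ### Symmetries and tensoriality of the curvature -/

lemma lieDeriv_lieDeriv_inner (hX : CMDiff ∞ (T% X)) (hY : CMDiff ∞ (T% Y))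
    (hZ : CMDiff ∞ (T% Z)) (hW : CMDiff ∞ (T% W)) (x : M) :
    lieDeriv X (lieDeriv Y (fun y ↦ (inner ℝ (Z y) (W y) : ℝ))) x
      = inner ℝ (cov X (cov Y Z) x) (W x) + inner ℝ (cov Y Z x) (cov X W x)
        + (inner ℝ (cov X Z x) (cov Y W x) + inner ℝ (Z x) (cov X (cov Y W) x)) := by
  rw [funext (lieDeriv_inner hY hZ hW), lieDeriv_add X (contMDiff_inner (contMDiff_cov hY hZ) hW)
    (contMDiff_inner hZ (contMDiff_cov hY hW)), lieDeriv_inner hX (contMDiff_cov hY hZ) hW,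
    lieDeriv_inner hX hZ (contMDiff_cov hY hW)]

/-- Apply [X,Y] = XY - YX to the function g(Z,W) and expand by metric compatibility; the terms with
one derivative on each factor cancel. -/
lemma inner_curv_swap (hX : CMDiff ∞ (T% X)) (hY : CMDiff ∞ (T% Y))
    (hZ : CMDiff ∞ (T% Z)) (hW : CMDiff ∞ (T% W)) (x : M) :
    (inner ℝ (curv X Y Z x) (W x) : ℝ) = -inner ℝ (Z x) (curv X Y W x) := by
  have h := lieDeriv_mlieBracket hX hY (contMDiff_inner hZ hW) x
  rw [lieDeriv_lieDeriv_inner hX hY hZ hW, lieDeriv_lieDeriv_inner hY hX hZ hW,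
    lieDeriv_inner (contMDiff_mlieBracket hX hY) hZ hW] at h
  simp only [curv, inner_sub_left, inner_sub_right]
  linarith

/-- Skewness moves the operator onto the test field, after which only the value of Z at `x` enters;
no Leibniz computation is needed. -/
lemma curv_congr (hX : CMDiff ∞ (T% X)) (hY : CMDiff ∞ (T% Y))
    (hZ : CMDiff ∞ (T% Z)) (hW : CMDiff ∞ (T% W)) {x : M} (h : Z x = W x) :
    curv X Y Z x = curv X Y W x := by
  refine ext_inner_right ℝ fun v ↦ ?_
  obtain ⟨V, hV, rfl⟩ := exists_contMDiff_apply_eq (I := I) v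
  rw [inner_curv_swap hX hY hZ hV, inner_curv_swap hX hY hW hV, h]

end

/-- The curvature operator is computed by smooth vector fields. -/
lemma exists_curvature_eq_curv [Nontrivial E] {x : M} (u v : TangentSpace I x) :
    ∃ X Y : Π y : M, TangentSpace I y, CMDiff ∞ (T% X) ∧ CMDiff ∞ (T% Y) ∧ X x = u ∧ Y x = v ∧
      ∀ Z : Π y : M, TangentSpace I y, CMDiff ∞ (T% Z) →
        curvature x u v (Z x) = curv X Y Z x := by
  -- X and Y share the germs at `x` of the extensions used in `curvature`, so tensoriality in the
  -- first two slots is never needed.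
  obtain ⟨X, hX, hXu⟩ := exists_contMDiff_eventuallyEq_extend (I := I) u
  obtain ⟨Y, hY, hYv⟩ := exists_contMDiff_eventuallyEq_extend (I := I) v
  refine ⟨X, Y, hX, hY, by rw [← hXu.self_of_nhds, extend_apply_self],
    by rw [← hYv.self_of_nhds, extend_apply_self], fun Z hZ ↦ ?_⟩
  obtain ⟨W, hW, hWw⟩ := exists_contMDiff_eventuallyEq_extend (I := I) (Z x)
  rw [curv_congr hX hY hZ hW (by rw [← hWw.self_of_nhds, extend_apply_self])]
  have hcongr : ∀ {S T : Π y : M, TangentSpace I y} {y : M}, CMDiff ∞ (T% T) →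
      (∀ᶠ z in 𝓝 y, S z = T z) → leviCivita I M S y = leviCivita I M T y := by
    intro S T y hT hST
    have hTy := mdiffAt_of_contMDiff hT y
    refine (leviCivita I M).isCovariantDerivativeOnUniv.congr_of_eventuallyEq
      (hTy.congr_of_eventuallyEq ?_) hTy Filter.univ_mem hST
    filter_upwards [hST] with z hz
    rw [hz]
  have hcov : ∀ {U V : Π y : M, TangentSpace I y}, (∀ᶠ y in 𝓝 x, U y = V y) →
      ∀ᶠ y in 𝓝 x, leviCivita I M (extend E (Z x) : Π y : M, TangentSpace I y) y (U y)
        = cov V W y := by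
    intro U V hUV
    filter_upwards [hUV, hWw.eventually_nhds] with y hy hy'
    rw [hcongr hW hy', hy, cov]
  rw [curvature, curv]
  rw [hcongr (contMDiff_cov hY hW) (hcov hYv), hcongr (contMDiff_cov hX hW) (hcov hXu),
    hcongr hW hWw, Filter.EventuallyEq.mlieBracket_vectorField_eq hXu hYv]
  simp only [cov, ← hXu.self_of_nhds, ← hYv.self_of_nhds, extend_apply_self]

omit [T2Space M] in
lemma curvatureForm_swap_left (x : M) (u v w z : TangentSpace I x) :
    curvatureForm x u v w z = -curvatureForm x v u w z := by
  rw [curvatureForm, curvatureForm, ← inner_neg_left]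
  congr 1
  simp only [curvature]
  rw [mlieBracket_swap_apply, map_neg]
  abel

lemma curvatureForm_swap_right [Nontrivial E] (x : M) (u v w z : TangentSpace I x) :
    curvatureForm x u v w z = -curvatureForm x u v z w := by
  obtain ⟨X, Y, hX, hY, -, -, h⟩ := exists_curvature_eq_curv u v
  obtain ⟨Z, hZ, rfl⟩ := exists_contMDiff_apply_eq (I := I) w
  obtain ⟨W, hW, rfl⟩ := exists_contMDiff_apply_eq (I := I) z
  rw [curvatureForm, curvatureForm, h Z hZ, h W hW, inner_curv_swap hX hY hZ hW, real_inner_comm]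

end Riem

namespace Riem

/-! ### Linear algebra of Sasakian structures at a point -/

section Pointwise

variable {V : Type*} [NormedAddCommGroup V] [InnerProductSpace ℝ V] {φ : V →ₗ[ℝ] V} {ξ : V}
  {η : V →ₗ[ℝ] ℝ}

lemma inner_reeb (η_ξ : η ξ = 1) (φ_ξ : φ ξ = 0)
    (inner_φ_φ : ∀ u v, (inner ℝ (φ u) (φ v) : ℝ) = inner ℝ u v - η u * η v) (u : V) :
    (inner ℝ u ξ : ℝ) = η u := by
  have := inner_φ_φ u ξ
  rw [φ_ξ, inner_zero_right, η_ξ] at this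
  linarith

lemma inner_φ_left (φ_φ : ∀ u, φ (φ u) = -u + η u • ξ) (η_ξ : η ξ = 1) (φ_ξ : φ ξ = 0)
    (η_φ : ∀ u, η (φ u) = 0)
    (inner_φ_φ : ∀ u v, (inner ℝ (φ u) (φ v) : ℝ) = inner ℝ u v - η u * η v) (u v : V) :
    (inner ℝ (φ u) v : ℝ) = -inner ℝ u (φ v) := by
  have := inner_φ_φ u (φ v)
  rw [φ_φ, inner_add_right, inner_neg_right, real_inner_smul_right,
    inner_reeb η_ξ φ_ξ inner_φ_φ, η_φ, η_φ] at this
  linarith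

/-- In a Sasakian structure the covariant derivative `A` of the Reeb field is `-φ`; here `N u v`
stands for `(∇_u φ) v`. -/
lemma nabla_reeb_of_normal (φ_φ : ∀ u, φ (φ u) = -u + η u • ξ) (η_ξ : η ξ = 1) (φ_ξ : φ ξ = 0)
    (η_φ : ∀ u, η (φ u) = 0)
    (inner_φ_φ : ∀ u v, (inner ℝ (φ u) (φ v) : ℝ) = inner ℝ u v - η u * η v)
    {A : V →ₗ[ℝ] V} {N : V → V → V}
    (hA : ∀ u v, (inner ℝ (A u) v - inner ℝ (A v) u : ℝ) = 2 * inner ℝ u (φ v))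
    (hAξ : ∀ u, (inner ℝ (A u) ξ : ℝ) = 0)
    (hskew : ∀ u v w, (inner ℝ (N u v) w : ℝ) = -inner ℝ (N u w) v)
    (hcyc : ∀ u v w, (inner ℝ (N u v) w + inner ℝ (N v w) u + inner ℝ (N w u) v : ℝ) = 0)
    (hNξ : ∀ u, N u ξ = -φ (A u))
    (hnorm : ∀ u v, N (φ u) v - N (φ v) u - φ (N u v) + φ (N v u)
      + (2 * inner ℝ u (φ v) : ℝ) • ξ = 0) (u : V) : A u = -φ u := by
  have hξ := inner_reeb η_ξ φ_ξ inner_φ_φ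
  have hφ := inner_φ_left φ_φ η_ξ φ_ξ η_φ inner_φ_φ
  have hAξ0 : A ξ = 0 := ext_inner_right ℝ fun w ↦ by
    have h1 := hA ξ w
    have h2 := hξ (φ w)
    rw [real_inner_comm] at h2
    rw [hAξ w, h2, η_φ] at h1
    rw [inner_zero_left]
    linarith
  -- `N` is not assumed linear; the cyclic and skew identities supply this value.
  have hN0 : ∀ v, N 0 v = 0 := fun v ↦ ext_inner_right ℝ fun w ↦ by
    have h1 := hcyc 0 v w
    have h2 := hskew w v 0
    rw [inner_zero_right] at h1
    rw [inner_zero_right] at h2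
    rw [inner_zero_left]
    linarith
  -- The cyclic identity at (ξ, v, w), with skewness, reduces N ξ v to values N · ξ; `hA` then moves
  -- A from w onto φv.
  have hNξ' : ∀ v, N ξ v = -φ (A v) - A (φ v) + (2 : ℝ) • (v - η v • ξ) := fun v ↦
    ext_inner_right ℝ fun w ↦ by
      have h1 := hcyc ξ v w
      have h2 := hskew v w ξ
      have h3 := hA w (φ v)
      have h4 := hφ (A w) v
      have h5 := inner_φ_φ w v
      have h6 := hφ w (φ v)
      have h7 := hξ w
      rw [hNξ, inner_neg_left] at h2
      rw [hNξ w, inner_neg_left] at h1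
      rw [real_inner_comm] at h7
      rw [real_inner_comm] at h5
      simp only [inner_add_left, inner_sub_left, inner_neg_left, real_inner_smul_left, h7]
      rw [real_inner_comm v w] at h5
      rw [real_inner_comm (φ w) (φ v)] at h5
      linarith
  -- Normality with second argument ξ: the φ²A terms cancel.
  have key : ∀ u, φ (A (φ u)) = φ u := fun u ↦ by
    have h := hnorm u ξ
    rw [φ_ξ, hN0, hNξ, hNξ, hNξ', inner_zero_right] at h
    simp only [map_add, map_sub, map_neg, map_smul, φ_ξ, smul_zero, sub_zero, mul_zero, zero_smul,
      add_zero] at h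
    have h2 : (2 : ℝ) • (φ u - φ (A (φ u))) = 0 := by
      rw [← h, smul_sub, two_smul ℝ (φ (A (φ u)))]
      abel
    have h3 := (smul_eq_zero.1 h2).resolve_left two_ne_zero
    exact (sub_eq_zero.1 h3).symm
  -- Applying φ loses nothing here, since the image of A is orthogonal to ξ. Evaluating at φu then
  -- gives A, because Aξ = 0.
  have key2 : ∀ u, A (φ u) = u - η u • ξ := fun u ↦ by
    have h := congrArg φ (key u)
    rw [φ_φ, φ_φ, ← hξ (A (φ u)), hAξ, zero_smul, add_zero] at h
    rw [← neg_inj, h]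
    abel
  have h := key2 (φ u)
  rw [φ_φ, η_φ, map_add, map_neg, map_smul, hAξ0, smul_zero, add_zero, zero_smul, sub_zero] at h
  rw [← h, neg_neg]

/-- The covariant derivative `N u v = (∇_u φ) v` of the tensor field `φ` of a Sasakian
structure. -/
lemma nabla_φ_of_normal (φ_φ : ∀ u, φ (φ u) = -u + η u • ξ) (η_ξ : η ξ = 1) (φ_ξ : φ ξ = 0)
    (η_φ : ∀ u, η (φ u) = 0)
    (inner_φ_φ : ∀ u v, (inner ℝ (φ u) (φ v) : ℝ) = inner ℝ u v - η u * η v)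
    {A : V →ₗ[ℝ] V} {N : V → V → V} (hA : ∀ u, A u = -φ u)
    (hskew : ∀ u v w, (inner ℝ (N u v) w : ℝ) = -inner ℝ (N u w) v)
    (hcyc : ∀ u v w, (inner ℝ (N u v) w + inner ℝ (N v w) u + inner ℝ (N w u) v : ℝ) = 0)
    (hC : ∀ u v, N u (φ v) + φ (N u v) = (inner ℝ (A u) v : ℝ) • ξ + η v • A u)
    (hNξ : ∀ u, N u ξ = -φ (A u))
    (hnorm : ∀ u v, N (φ u) v - N (φ v) u - φ (N u v) + φ (N v u)
      + (2 * inner ℝ u (φ v) : ℝ) • ξ = 0) (u v : V) :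
    N u v = (inner ℝ u v : ℝ) • ξ - η v • u := by
  have hξ := inner_reeb η_ξ φ_ξ inner_φ_φ
  have hξ' : ∀ u, (inner ℝ ξ u : ℝ) = η u := fun u ↦ by rw [real_inner_comm, hξ]
  have hφ := inner_φ_left φ_φ η_ξ φ_ξ η_φ inner_φ_φ
  -- The defect of the claimed formula, paired with w. The model tensor satisfies all the
  -- hypotheses, so q satisfies their homogeneous versions.
  let q : V → V → V → ℝ := fun u v w ↦ inner ℝ (N u v) w - inner ℝ u v * η w + η v * inner ℝ u w
  have q_skew : ∀ u v w, q u v w = -q u w v := fun u v w ↦ by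
    simp only [q]
    linarith [hskew u v w]
  have q_cyc : ∀ u v w, q u v w + q v w u + q w u v = 0 := fun u v w ↦ by
    have h := hcyc u v w
    simp only [q]
    rw [real_inner_comm u v, real_inner_comm w u, real_inner_comm v w]
    linarith
  have q_φ : ∀ u v w, q u (φ v) w = q u v (φ w) := fun u v w ↦ by
    have h := congrArg (fun z ↦ (inner ℝ z w : ℝ)) (hC u v)
    simp only [inner_add_left, real_inner_smul_left, hA, inner_neg_left, hξ'] at h
    simp only [q, η_φ]
    rw [hφ (N u v) w, hφ u v, hφ u w] at h
    linarith
  have q_normal : ∀ u v w, q (φ u) v w + q u v (φ w) = q (φ v) u w + q v u (φ w) := fun u v w ↦ by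
    have h := congrArg (fun z ↦ (inner ℝ z w : ℝ)) (hnorm u v)
    simp only [inner_add_left, inner_sub_left, real_inner_smul_left, hξ', inner_zero_left] at h
    rw [hφ (N u v) w, hφ (N v u) w] at h
    simp only [q, η_φ]
    rw [hφ u v, hφ u w, hφ v w, real_inner_comm u (φ v)]
    linarith
  have q_φ_left : ∀ u v w, q (φ u) v w = -q u v (φ w) := by
    -- A trilinear-type expression symmetric in its first two arguments and skew in its last two
    -- vanishes.
    let S : V → V → V → ℝ := fun u v w ↦ q (φ u) v w + q u v (φ w)
    have S_symm : ∀ u v w, S u v w = S v u w := q_normal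
    have S_skew : ∀ u v w, S u v w = -S u w v := fun u v w ↦ by
      simp only [S]
      rw [q_skew (φ u) v w, q_skew u v (φ w), q_φ]
      ring
    intro u v w
    have h : S u v w = 0 := by
      linarith [S_symm u v w, S_skew v u w, S_symm v w u, S_skew w v u, S_symm w u v, S_skew u w v]
    simp only [S] at h
    linarith
  -- The cyclic identity at (φu, v, w) reads -a + b + c = 0 for the three rotations a, b, c of q(u,
  -- v, φw); adding two rotations of it kills each term.
  have q_φ_right : ∀ u v w, q u v (φ w) = 0 := by
    have h : ∀ u v w, -q u v (φ w) + q v w (φ u) + q w u (φ v) = 0 := fun u v w ↦ by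
      rw [← q_φ_left, ← q_φ w u v]
      exact q_cyc (φ u) v w
    intro u v w
    linarith [h u v w, h v w u, h w u v]
  -- Since w = -φ²w + η(w)ξ, it remains only to check q(u, v, ξ) = 0, where ∇ξ = -φ enters.
  have q_zero : ∀ u v w, q u v w = 0 := fun u v w ↦ by
    have h1 := q_φ_right u v (φ w)
    have h2 : q u v ξ = 0 := by
      rw [q_skew]
      simp only [q, hNξ, hA, map_neg, φ_φ, neg_neg, inner_add_left, inner_neg_left,
        real_inner_smul_left, hξ', hξ, η_ξ]
      ring
    rw [φ_φ] at h1
    simp only [q, inner_add_right, inner_neg_right, inner_smul_right, map_add, map_neg, map_smul,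
      smul_eq_mul] at h1 h2 ⊢
    linear_combination -h1 + η w * h2
  refine ext_inner_right ℝ fun w ↦ ?_
  have := q_zero u v w
  simp only [q] at this
  rw [inner_sub_left, real_inner_smul_left, real_inner_smul_left, hξ']
  linarith

end Pointwise

end Riem

namespace Riem

/-! ### Covariant derivatives of the structure tensors of a Sasakian manifold -/

variable {E : Type*} [NormedAddCommGroup E] [NormedSpace ℝ E]
  {H : Type*} [TopologicalSpace H] {I : ModelWithCorners ℝ E H}
  {M : Type*} [TopologicalSpace M] [ChartedSpace H M] [IsManifold I ∞ M]
  [RiemannianBundle (fun x : M ↦ TangentSpace I x)]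

namespace AlmostContactMetric

variable (S : AlmostContactMetric I M)

/-- The vector field `φ Y`. -/
def φField (Y : Π y : M, TangentSpace I y) (x : M) : TangentSpace I x := S.φ x (Y x)

lemma inner_ξ (x : M) (u : TangentSpace I x) : (inner ℝ u (S.ξ x) : ℝ) = S.η x u :=
  inner_reeb (φ := (S.φ x).toLinearMap) (η := (S.η x).toLinearMap) (S.η_ξ x) (S.φ_ξ x)
    (S.inner_φ_φ x) u

lemma inner_φ_left (x : M) (u v : TangentSpace I x) :
    (inner ℝ (S.φ x u) v : ℝ) = -inner ℝ u (S.φ x v) :=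
  Riem.inner_φ_left (φ := (S.φ x).toLinearMap) (η := (S.η x).toLinearMap) (S.φ_φ x) (S.η_ξ x)
    (S.φ_ξ x) (S.η_φ x) (S.inner_φ_φ x) u v

variable {X Y Z : Π y : M, TangentSpace I y}

lemma contMDiff_φField (hY : CMDiff ∞ (T% Y)) : CMDiff ∞ (T% (S.φField Y)) :=
  ContMDiff.clm_bundle_apply (E₁ := fun x : M ↦ TangentSpace I x)
    (E₂ := fun x : M ↦ TangentSpace I x) (b := fun y ↦ y) (ϕ := S.φ) (v := Y) S.φ_smooth hY

variable [IsContMDiffRiemannianBundle I ∞ E (fun x : M ↦ TangentSpace I x)]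

lemma contMDiff_η (hY : CMDiff ∞ (T% Y)) : CMDiff ∞ (fun y ↦ S.η y (Y y)) := by
  simp only [← S.inner_ξ]
  exact contMDiff_inner hY S.ξ_smooth

variable [FiniteDimensional ℝ E]

/-- The field `(∇_X φ) Y`. -/
def covφ (X Y : Π y : M, TangentSpace I y) (x : M) : TangentSpace I x :=
  cov X (S.φField Y) x - S.φ x (cov X Y x)

lemma lieDeriv_η (hX : CMDiff ∞ (T% X)) (hY : CMDiff ∞ (T% Y)) (x : M) :
    lieDeriv X (fun y ↦ S.η y (Y y)) x = S.η x (cov X Y x) + inner ℝ (cov X S.ξ x) (Y x) := by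
  simp only [← S.inner_ξ]
  rw [lieDeriv_inner hX hY S.ξ_smooth, real_inner_comm (Y x)]

lemma inner_cov_ξ_ξ (hX : CMDiff ∞ (T% X)) (x : M) :
    (inner ℝ (cov X S.ξ x) (S.ξ x) : ℝ) = 0 := by
  have h := lieDeriv_inner hX S.ξ_smooth S.ξ_smooth x
  simp only [S.inner_ξ, S.η_ξ] at h
  rw [← S.inner_ξ, real_inner_comm (cov X S.ξ x), lieDeriv, mvfderiv_const, zero_apply] at h
  linarith

/-- Differentiate g(φY,Z) + g(Y,φZ) = 0 along X. -/
lemma inner_covφ_swap (hX : CMDiff ∞ (T% X)) (hY : CMDiff ∞ (T% Y)) (hZ : CMDiff ∞ (T% Z))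
    (x : M) : (inner ℝ (S.covφ X Y x) (Z x) : ℝ) = -inner ℝ (S.covφ X Z x) (Y x) := by
  have h1 := lieDeriv_inner hX (S.contMDiff_φField hY) hZ x
  have h2 := lieDeriv_inner hX hY (S.contMDiff_φField hZ) x
  have h3 := lieDeriv_add X (contMDiff_inner (S.contMDiff_φField hY) hZ)
    (contMDiff_inner hY (S.contMDiff_φField hZ)) x
  have h4 : (fun y ↦ (inner ℝ (S.φField Y y) (Z y) + inner ℝ (Y y) (S.φField Z y) : ℝ))
      = fun _ ↦ 0 := by
    funext y
    rw [φField, inner_φ_left, φField]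
    ring
  rw [h4, lieDeriv, mvfderiv_const, zero_apply] at h3
  have h5 := S.inner_φ_left x (cov X Y x) (Z x)
  have h6 := S.inner_φ_left x (cov X Z x) (Y x)
  simp only [covφ, inner_sub_left]
  rw [real_inner_comm (cov X (S.φField Z) x)] at h2
  rw [real_inner_comm (cov X Z x)] at h1
  simp only [φField] at h1 h2 h3 ⊢
  linarith

lemma covφ_congr [T2Space M] (hX : CMDiff ∞ (T% X)) (hY : CMDiff ∞ (T% Y))
    (hZ : CMDiff ∞ (T% Z)) {x : M} (h : Y x = Z x) : S.covφ X Y x = S.covφ X Z x := by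
  refine ext_inner_right ℝ fun v ↦ ?_
  obtain ⟨V, hV, rfl⟩ := exists_contMDiff_apply_eq (I := I) v
  rw [S.inner_covφ_swap hX hY hV, S.inner_covφ_swap hX hZ hV, h]

/-- Differentiate φ² = -id + η ⊗ ξ along X. -/
lemma covφ_φ (hX : CMDiff ∞ (T% X)) (hY : CMDiff ∞ (T% Y)) (x : M) :
    S.covφ X (S.φField Y) x + S.φ x (S.covφ X Y x)
      = (inner ℝ (cov X S.ξ x) (Y x) : ℝ) • S.ξ x + S.η x (Y x) • cov X S.ξ x := by
  have h : S.φField (S.φField Y) = -Y + (fun y ↦ S.η y (Y y)) • S.ξ :=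
    funext fun y ↦ S.φ_φ y (Y y)
  have h2 : cov X (S.φField (S.φField Y)) x = -cov X Y x + (S.η x (Y x) • cov X S.ξ x
      + (S.η x (cov X Y x) + inner ℝ (cov X S.ξ x) (Y x)) • S.ξ x) := by
    rw [h, cov_add hY.neg_section ((S.contMDiff_η hY).smul_section S.ξ_smooth), cov_neg hY,
      cov_smul (S.contMDiff_η hY) S.ξ_smooth, S.lieDeriv_η hX hY]
  rw [covφ, covφ, h2, map_sub, S.φ_φ, add_smul]
  abel

lemma covφ_ξ (X : Π y : M, TangentSpace I y) (x : M) :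
    S.covφ X S.ξ x = -S.φ x (cov X S.ξ x) := by
  have h : S.φField S.ξ = 0 := funext S.φ_ξ
  rw [covφ, h]
  simp [cov]

end AlmostContactMetric

namespace Sasakian

variable (S : Sasakian I M) {X Y Z : Π y : M, TangentSpace I y}

lemma contact_lieDeriv (hX : CMDiff ∞ (T% X)) (hY : CMDiff ∞ (T% Y)) (x : M) :
    lieDeriv X (fun y ↦ S.η y (Y y)) x - lieDeriv Y (fun y ↦ S.η y (X y)) x
      - S.η x (mlieBracket I X Y x) = 2 * inner ℝ (X x) (S.φ x (Y x)) := by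
  have h := S.contact x X Y (hX x) (hY x)
  simp only [extDeriv] at h
  simp only [lieDeriv]
  linarith

variable [IsContMDiffRiemannianBundle I ∞ E (fun x : M ↦ TangentSpace I x)]
  [FiniteDimensional ℝ E]

lemma inner_cov_ξ_sub (hX : CMDiff ∞ (T% X)) (hY : CMDiff ∞ (T% Y)) (x : M) :
    (inner ℝ (cov X S.ξ x) (Y x) - inner ℝ (cov Y S.ξ x) (X x) : ℝ)
      = 2 * inner ℝ (X x) (S.φ x (Y x)) := by
  rw [← S.contact_lieDeriv hX hY, S.lieDeriv_η hX hY, S.lieDeriv_η hY hX, ← cov_sub_cov hX hY,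
    map_sub]
  ring

/-- Zero torsion rewrites each bracket of the Nijenhuis tensor as a difference of covariant
derivatives, which regroup into ∇φ. -/
lemma covφ_normal (hX : CMDiff ∞ (T% X)) (hY : CMDiff ∞ (T% Y)) (x : M) :
    S.covφ (S.φField X) Y x - S.covφ (S.φField Y) X x - S.φ x (S.covφ X Y x)
      + S.φ x (S.covφ Y X x) + (2 * inner ℝ (X x) (S.φ x (Y x)) : ℝ) • S.ξ x = 0 := by
  have h := S.normal x X Y (hX x) (hY x)
  rw [S.contact x X Y (hX x) (hY x)] at h
  have hφX := S.contMDiff_φField hX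
  have hφY := S.contMDiff_φField hY
  have h1 := cov_sub_cov hX hY x
  have h2 := cov_sub_cov hφX hφY x
  have h3 := cov_sub_cov hφX hY x
  have h4 := cov_sub_cov hX hφY x
  change S.φ x (S.φ x (mlieBracket I X Y x)) + mlieBracket I (S.φField X) (S.φField Y) x
    - S.φ x (mlieBracket I (S.φField X) Y x) - S.φ x (mlieBracket I X (S.φField Y) x) + _ = 0 at h
  rw [← h1, ← h2, ← h3, ← h4] at h
  simp only [map_sub] at h
  simp only [AlmostContactMetric.covφ, map_sub]
  rw [← h]
  abel

variable [T2Space M] [Nontrivial E]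

/-- The form `g(X, φ Y)` is closed, being exact. -/
lemma closed (hX : CMDiff ∞ (T% X)) (hY : CMDiff ∞ (T% Y)) (hZ : CMDiff ∞ (T% Z)) (x : M) :
    lieDeriv X (fun y ↦ (inner ℝ (Y y) (S.φ y (Z y)) : ℝ)) x
        - inner ℝ (mlieBracket I X Y x) (S.φ x (Z x))
      + (lieDeriv Y (fun y ↦ (inner ℝ (Z y) (S.φ y (X y)) : ℝ)) x
        - inner ℝ (mlieBracket I Y Z x) (S.φ x (X x)))
      + (lieDeriv Z (fun y ↦ (inner ℝ (X y) (S.φ y (Y y)) : ℝ)) x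
        - inner ℝ (mlieBracket I Z X x) (S.φ x (Y x))) = 0 := by
  have hd : ∀ {X Y Z : Π y : M, TangentSpace I y}, CMDiff ∞ (T% X) → CMDiff ∞ (T% Y) →
      CMDiff ∞ (T% Z) →
      2 * lieDeriv X (fun y ↦ (inner ℝ (Y y) (S.φ y (Z y)) : ℝ)) x
        = lieDeriv X (lieDeriv Y (fun y ↦ S.η y (Z y))) x
          - lieDeriv X (lieDeriv Z (fun y ↦ S.η y (Y y))) x
          - lieDeriv X (fun y ↦ S.η y (mlieBracket I Y Z y)) x := by
    intro X Y Z hX hY hZ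
    have h1 := contMDiff_lieDeriv hY (S.contMDiff_η hZ)
    have h2 := contMDiff_lieDeriv hZ (S.contMDiff_η hY)
    have h3 := S.contMDiff_η (contMDiff_mlieBracket hY hZ)
    have h4 : CMDiff ∞ (fun y ↦ (inner ℝ (Y y) (S.φ y (Z y)) : ℝ)) :=
      contMDiff_inner hY (S.contMDiff_φField hZ)
    rw [two_mul, ← lieDeriv_add X h4 h4, ← lieDeriv_sub X h1 h2, ← lieDeriv_sub X (h1.sub h2) h3]
    congr 1
    funext y
    rw [S.contact_lieDeriv hY hZ, two_mul]
  have hXY := contMDiff_mlieBracket hX hY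
  have hYZ := contMDiff_mlieBracket hY hZ
  have hZX := contMDiff_mlieBracket hZ hX
  have e1 := hd hX hY hZ
  have e2 := hd hY hZ hX
  have e3 := hd hZ hX hY
  -- With brackets acting as commutators, the second derivatives of η cancel in the cyclic sum, and
  -- the double brackets cancel by Jacobi.
  have c1 := S.contact_lieDeriv hXY hZ x
  have c2 := S.contact_lieDeriv hYZ hX x
  have c3 := S.contact_lieDeriv hZX hY x
  rw [lieDeriv_mlieBracket hX hY (S.contMDiff_η hZ)] at c1
  rw [lieDeriv_mlieBracket hY hZ (S.contMDiff_η hX)] at c2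
  rw [lieDeriv_mlieBracket hZ hX (S.contMDiff_η hY)] at c3
  have hj : S.η x (mlieBracket I (mlieBracket I X Y) Z x)
      + S.η x (mlieBracket I (mlieBracket I Y Z) X x)
      + S.η x (mlieBracket I (mlieBracket I Z X) Y x) = 0 := by
    have h := congrArg (S.η x) (mlieBracket_jacobi hX hY hZ x)
    have h' : mlieBracket I Y (mlieBracket I X Z) x
        = mlieBracket I (mlieBracket I Z X) Y x := by
      rw [mlieBracket_swap_apply, mlieBracket_swap (V := X) (W := Z), ← Pi.neg_apply,
        ← mlieBracket_swap]
      have := mlieBracket_const_smul_left (I := I) (𝕜 := ℝ) (c := -1) (W := Y)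
        (mdiffAt_of_contMDiff hZX x)
      rw [neg_one_smul, neg_one_smul] at this
      rw [mlieBracket_swap, Pi.neg_apply, this, neg_neg]
    rw [map_add, h', mlieBracket_swap_apply, map_neg] at h
    linarith
  linarith

/-- For a torsion-free connection, closedness of g(·,φ·) is the vanishing of the cyclic sum of its
covariant derivative. -/
lemma inner_covφ_cyclic (hX : CMDiff ∞ (T% X)) (hY : CMDiff ∞ (T% Y)) (hZ : CMDiff ∞ (T% Z))
    (x : M) : (inner ℝ (S.covφ X Y x) (Z x) + inner ℝ (S.covφ Y Z x) (X x)
      + inner ℝ (S.covφ Z X x) (Y x) : ℝ) = 0 := by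
  have h := S.closed hX hY hZ x
  have hl : ∀ {X Y Z : Π y : M, TangentSpace I y}, CMDiff ∞ (T% X) → CMDiff ∞ (T% Y) →
      CMDiff ∞ (T% Z) → lieDeriv X (fun y ↦ (inner ℝ (Y y) (S.φ y (Z y)) : ℝ)) x
        = inner ℝ (cov X Y x) (S.φ x (Z x)) - inner ℝ (S.covφ X Y x) (Z x)
          - inner ℝ (cov X Z x) (S.φ x (Y x)) := by
    intro X Y Z hX hY hZ
    refine (lieDeriv_inner hX hY (S.contMDiff_φField hZ) x).trans ?_
    have h1 := S.inner_covφ_swap hX hY hZ x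
    have h2 := S.inner_φ_left x (cov X Z x) (Y x)
    have h3 := real_inner_comm (Y x) (cov X (S.φField Z) x)
    simp only [AlmostContactMetric.covφ, inner_sub_left] at h1 ⊢
    simp only [AlmostContactMetric.φField] at h1 h3 ⊢
    linarith
  rw [hl hX hY hZ, hl hY hZ hX, hl hZ hX hY, ← cov_sub_cov hX hY, ← cov_sub_cov hY hZ,
    ← cov_sub_cov hZ hX] at h
  simp only [inner_sub_left] at h
  linarith

/-- On a Sasakian manifold `∇_X ξ = -φ X` and `(∇_X φ) Y = g(X, Y) ξ - η(Y) X`. -/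
lemma cov_ξ_and_covφ (x : M) : (∀ u, leviCivita I M S.ξ x u = -S.φ x u) ∧
    ∀ {X Y : Π y : M, TangentSpace I y}, CMDiff ∞ (T% X) → CMDiff ∞ (T% Y) →
      S.covφ X Y x = (inner ℝ (X x) (Y x) : ℝ) • S.ξ x - S.η x (Y x) • X x := by
  choose F hF hFx using fun u : TangentSpace I x ↦ exists_contMDiff_apply_eq u
  let N : TangentSpace I x → TangentSpace I x → TangentSpace I x :=
    fun u v ↦ S.covφ (F u) (F v) x
  -- The choice of fields through given vectors is immaterial: ∇_X depends on X pointwise, and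
  -- `covφ_congr` handles Y.
  have hN : ∀ {X Y : Π y : M, TangentSpace I y}, CMDiff ∞ (T% X) → CMDiff ∞ (T% Y) →
      N (X x) (Y x) = S.covφ X Y x := by
    intro X Y hX hY
    simp only [N]
    rw [S.covφ_congr (hF _) (hF _) hY (hFx _)]
    simp only [AlmostContactMetric.covφ, cov, hFx]
  have hskew : ∀ u v w, (inner ℝ (N u v) w : ℝ) = -inner ℝ (N u w) v := fun u v w ↦ by
    simpa only [hFx] using S.inner_covφ_swap (hF u) (hF v) (hF w) x
  have hcyc : ∀ u v w, (inner ℝ (N u v) w + inner ℝ (N v w) u + inner ℝ (N w u) v : ℝ) = 0 :=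
    fun u v w ↦ by simpa only [hFx] using S.inner_covφ_cyclic (hF u) (hF v) (hF w) x
  have hNφ : ∀ u v, N u (S.φ x v) = S.covφ (F u) (S.φField (F v)) x := fun u v ↦ by
    rw [← hN (hF u) (S.contMDiff_φField (hF v)), hFx, AlmostContactMetric.φField, hFx]
  have hNφ' : ∀ u v, N (S.φ x u) v = S.covφ (S.φField (F u)) (F v) x := fun u v ↦ by
    rw [← hN (S.contMDiff_φField (hF u)) (hF v), hFx, AlmostContactMetric.φField, hFx]
  have hC : ∀ u v, N u (S.φ x v) + S.φ x (N u v)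
      = (inner ℝ (leviCivita I M S.ξ x u) v : ℝ) • S.ξ x
        + S.η x v • leviCivita I M S.ξ x u := fun u v ↦ by
    have h := S.covφ_φ (hF u) (hF v) x
    simp only [cov, hFx] at h
    rw [hNφ, ← h]
  have hNξ : ∀ u, N u (S.ξ x) = -S.φ x (leviCivita I M S.ξ x u) := fun u ↦ by
    have h := S.covφ_ξ (F u) x
    rw [cov, hFx, ← hN (hF u) S.ξ_smooth, hFx] at h
    exact h
  have hnorm : ∀ u v, N (S.φ x u) v - N (S.φ x v) u - S.φ x (N u v) + S.φ x (N v u)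
      + (2 * inner ℝ u (S.φ x v) : ℝ) • S.ξ x = 0 := fun u v ↦ by
    have h := S.covφ_normal (hF u) (hF v) x
    rw [hFx, hFx] at h
    rw [hNφ', hNφ', ← h]
  have hA : ∀ u, leviCivita I M S.ξ x u = -S.φ x u :=
    nabla_reeb_of_normal (φ := (S.φ x).toLinearMap) (η := (S.η x).toLinearMap) (S.φ_φ x)
      (S.η_ξ x) (S.φ_ξ x) (S.η_φ x) (S.inner_φ_φ x) (A := (leviCivita I M S.ξ x).toLinearMap)
      (N := N)
      (fun u v ↦ by simpa only [cov, hFx] using! S.inner_cov_ξ_sub (hF u) (hF v) x)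
      (fun u ↦ by simpa only [cov, hFx] using! S.inner_cov_ξ_ξ (hF u) x) hskew hcyc hNξ hnorm
  refine ⟨hA, fun {X Y} hX hY ↦ ?_⟩
  rw [← hN hX hY]
  exact nabla_φ_of_normal (φ := (S.φ x).toLinearMap) (η := (S.η x).toLinearMap) (S.φ_φ x)
      (S.η_ξ x) (S.φ_ξ x) (S.η_φ x) (S.inner_φ_φ x) (A := (leviCivita I M S.ξ x).toLinearMap)
      (N := N) hA hskew hcyc hC hNξ hnorm (X x) (Y x)

end Sasakian

end Riem

namespace Riem

/-! ### Curvature of Sasakian manifolds -/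

namespace Sasakian

variable {E : Type*} [NormedAddCommGroup E] [NormedSpace ℝ E] [FiniteDimensional ℝ E]
  [Nontrivial E] {H : Type*} [TopologicalSpace H] {I : ModelWithCorners ℝ E H}
  {M : Type*} [TopologicalSpace M] [T2Space M] [ChartedSpace H M] [IsManifold I ∞ M]
  [RiemannianBundle (fun x : M ↦ TangentSpace I x)]
  [IsContMDiffRiemannianBundle I ∞ E (fun x : M ↦ TangentSpace I x)]
  (S : Sasakian I M) {X Y Z : Π y : M, TangentSpace I y}

lemma cov_ξ (X : Π y : M, TangentSpace I y) (x : M) : cov X S.ξ x = -S.φ x (X x) :=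
  (S.cov_ξ_and_covφ x).1 _

lemma cov_φField (hX : CMDiff ∞ (T% X)) (hY : CMDiff ∞ (T% Y)) (x : M) :
    cov X (S.φField Y) x = S.φ x (cov X Y x) + (inner ℝ (X x) (Y x) : ℝ) • S.ξ x
      - S.η x (Y x) • X x := by
  rw [add_sub_assoc, ← (S.cov_ξ_and_covφ x).2 hX hY, AlmostContactMetric.covφ]
  abel

/-- Since ∇ξ = -φ, R(X,Y)ξ = (∇_Y φ)X - (∇_X φ)Y. -/
lemma curv_ξ (hX : CMDiff ∞ (T% X)) (hY : CMDiff ∞ (T% Y)) (x : M) :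
    curv X Y S.ξ x = S.η x (Y x) • X x - S.η x (X x) • Y x := by
  have h : ∀ Y : Π y : M, TangentSpace I y, cov Y S.ξ = -S.φField Y := fun Y ↦
    funext fun y ↦ S.cov_ξ Y y
  rw [curv, h, h, h, cov_neg (S.contMDiff_φField hY), cov_neg (S.contMDiff_φField hX),
    S.cov_φField hX hY, S.cov_φField hY hX, Pi.neg_apply, AlmostContactMetric.φField,
    ← cov_sub_cov hX hY, map_sub, real_inner_comm]
  abel

lemma cov_cov_φField (hX : CMDiff ∞ (T% X)) (hY : CMDiff ∞ (T% Y)) (hZ : CMDiff ∞ (T% Z))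
    (x : M) : cov X (cov Y (S.φField Z)) x = S.φ x (cov X (cov Y Z) x)
      + (inner ℝ (X x) (cov Y Z x) + inner ℝ (cov X Y x) (Z x) + inner ℝ (Y x) (cov X Z x) : ℝ)
        • S.ξ x
      - S.η x (cov Y Z x) • X x - (inner ℝ (Y x) (Z x) : ℝ) • S.φ x (X x)
      - S.η x (Z x) • cov X Y x
      - (S.η x (cov X Z x) - inner ℝ (S.φ x (X x)) (Z x)) • Y x := by
  have hYZ := contMDiff_cov hY hZ
  have h : cov Y (S.φField Z) = S.φField (cov Y Z)
      + (fun y ↦ (inner ℝ (Y y) (Z y) : ℝ)) • S.ξ - (fun y ↦ S.η y (Z y)) • Y :=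
    funext fun y ↦ S.cov_φField hY hZ y
  have h1 := (contMDiff_inner hY hZ).smul_section S.ξ_smooth
  have h2 := (S.contMDiff_η hZ).smul_section hY
  rw [h, cov_sub ((S.contMDiff_φField hYZ).add_section h1) h2,
    cov_add (S.contMDiff_φField hYZ) h1, cov_smul (contMDiff_inner hY hZ) S.ξ_smooth,
    cov_smul (S.contMDiff_η hZ) hY, S.cov_φField hX hYZ, S.cov_ξ, lieDeriv_inner hX hY hZ,
    S.lieDeriv_η hX hZ, S.cov_ξ, inner_neg_left]
  module

/-- Antisymmetrising the second derivatives of φZ, the coefficients with derivatives of Y or Z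
cancel against ∇_[X,Y](φZ). What survives comes from ∇ξ = -φ, in the derivatives of ξ and of η(Z).
-/
lemma curv_φField (hX : CMDiff ∞ (T% X)) (hY : CMDiff ∞ (T% Y)) (hZ : CMDiff ∞ (T% Z))
    (x : M) : curv X Y (S.φField Z) x = S.φ x (curv X Y Z x)
      - (inner ℝ (Y x) (Z x) : ℝ) • S.φ x (X x) + (inner ℝ (S.φ x (X x)) (Z x) : ℝ) • Y x
      + (inner ℝ (X x) (Z x) : ℝ) • S.φ x (Y x) - (inner ℝ (S.φ x (Y x)) (Z x) : ℝ) • X x := by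
  rw [curv, curv, S.cov_cov_φField hX hY hZ, S.cov_cov_φField hY hX hZ,
    S.cov_φField (contMDiff_mlieBracket hX hY) hZ, map_sub, map_sub, ← cov_sub_cov hX hY,
    inner_sub_left]
  module

lemma curvature_ξ (x : M) (u v : TangentSpace I x) :
    curvature x u v (S.ξ x) = S.η x v • u - S.η x u • v := by
  obtain ⟨X, Y, hX, hY, rfl, rfl, h⟩ := exists_curvature_eq_curv u v
  rw [h _ S.ξ_smooth, S.curv_ξ hX hY]

lemma curvature_φ (x : M) (u v w : TangentSpace I x) :
    curvature x u v (S.φ x w) = S.φ x (curvature x u v w)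
      - (inner ℝ v w : ℝ) • S.φ x u + (inner ℝ (S.φ x u) w : ℝ) • v
      + (inner ℝ u w : ℝ) • S.φ x v - (inner ℝ (S.φ x v) w : ℝ) • u := by
  obtain ⟨X, Y, hX, hY, rfl, rfl, h⟩ := exists_curvature_eq_curv u v
  obtain ⟨Z, hZ, rfl⟩ := exists_contMDiff_apply_eq (I := I) w
  have h1 := h _ (S.contMDiff_φField hZ)
  rw [S.curv_φField hX hY hZ, ← h Z hZ, AlmostContactMetric.φField] at h1
  exact h1

/-- The terms of the trace defining the `*`-Ricci tensor. -/
lemma curvatureForm_φ_φ (x : M) (u v e : TangentSpace I x) (he : (inner ℝ e e : ℝ) = 1) :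
    curvatureForm x u e (S.φ x e) (S.φ x v) = curvatureForm x e u v e
      - inner ℝ u v + inner ℝ (S.φ x u) e * inner ℝ e (S.φ x v) + inner ℝ u e * inner ℝ e v := by
  -- Needed because g(φa,φv) = g(a,v) - η(a)η(v) with a = R(u,e)e. In the end all terms containing η
  -- cancel.
  have h1 : S.η x (curvature x u e e) = S.η x u - S.η x e * inner ℝ u e := by
    have h := curvatureForm_swap_right x u e e (S.ξ x)
    rw [curvatureForm, curvatureForm, S.inner_ξ, S.curvature_ξ, inner_sub_left,
      real_inner_smul_left, real_inner_smul_left, he] at h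
    linarith
  have h2 : (inner ℝ (curvature x u e e) v : ℝ) = curvatureForm x e u v e := by
    have h := curvatureForm_swap_left x u e e v
    rw [curvatureForm_swap_right x e u e v, neg_neg] at h
    exact h
  have h3 : (inner ℝ (S.φ x e) e : ℝ) = 0 := by
    have h := S.inner_φ_left x e e
    rw [real_inner_comm] at h
    rw [real_inner_comm]
    linarith
  rw [curvatureForm, S.curvature_φ]
  simp only [inner_add_left, inner_sub_left, real_inner_smul_left, S.inner_φ_φ, h1, h2, h3, he]
  ring

end Sasakian

end Riem

end

theorem mainTheorem8 (n : ℕ)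
    {E : Type*} [NormedAddCommGroup E] [NormedSpace ℝ E] [FiniteDimensional ℝ E]
    (hE : Module.finrank ℝ E = 2 * n + 1)
    {H : Type*} [TopologicalSpace H] (I : ModelWithCorners ℝ E H)
    {M : Type*} [TopologicalSpace M] [T2Space M] [SecondCountableTopology M]
    [ChartedSpace H M] [IsManifold I ∞ M] [BoundarylessManifold I M]
    [RiemannianBundle (fun x : M ↦ TangentSpace I x)]
    [IsContMDiffRiemannianBundle I ∞ E (fun x : M ↦ TangentSpace I x)]
    (S : Riem.Sasakian I M) (x : M) (u v : TangentSpace I x) :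
    S.starRicci x u v
      = Riem.ricci x u v - (2 * (n : ℝ) - 1) * inner ℝ u v - S.η x u * S.η x v := by
  have : Nontrivial E := Module.nontrivial_of_finrank_pos (R := ℝ) (by omega)
  have hdim : Module.finrank ℝ (TangentSpace I x) = 2 * n + 1 := hE
  rw [Riem.AlmostContactMetric.starRicci, Riem.ricci]
  set e := stdOrthonormalBasis ℝ (TangentSpace I x)
  have he : ∀ i, (inner ℝ (e i) (e i) : ℝ) = 1 := fun i ↦ by
    rw [real_inner_self_eq_norm_sq, e.norm_eq_one, one_pow]
  -- Parseval turns the two product sums into g(φu,φv) = g(u,v) - η(u)η(v) and g(u,v); with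
  -- -(2n+1)g(u,v) from the constant term, the coefficient of g is -(2n-1).
  simp only [fun i ↦ S.curvatureForm_φ_φ x u v (e i) (he i), Finset.sum_add_distrib,
    Finset.sum_sub_distrib, e.sum_inner_mul_inner, S.inner_φ_φ, Finset.sum_const,
    Finset.card_univ, Fintype.card_fin, hdim, nsmul_eq_mul]
  push_cast
  ring
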